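/- All vector spaces are real. Let $X$ and $Z$ be Hausdorff topological vector spaces and let $C\subseteq Z$ be a convex cone (that is, $0\in C$, $C+C\subseteq C$ and $tC\subseteq C$ for all $t\ge 0$) which is pointed, i.e. $C\cap(-C)=\{0\}$, and has nonempty interior $\operatorname{int}C$. Let $K\subseteq X$ be nonempty, convex and closed, and let $F:K\times K\times K\to Z$ satisfy: (i) for every $y\in K$ at least one of the following holds: - (a) for every net $(x_\alpha)\subseteq K$ converging to some $x\in K$, if $F(x_\alpha,y,x_\alpha)\notin-\operatorname{int}C$ for all $\alpha$, then $F(x,y,x)\notin-\operatorname{int}C$; - (b) the map $f(x)=F(x,y,x)$ is $C$-upper semicontinuous on $K$, i.e. for every $x\in K$ and every neighbourhood $V$ of $f(x)$ there is a neighbourhood $U$ of $x$ with $f(u)\in V-C$ for all $u\in U\cap K$; - (c) for every $x\in K$ and every net $(x_\alpha)\subseteq K$ converging to $x$ there is a net $(z_\alpha)\subseteq Z$, with the same index set, converging to some $z\in Z$, such that $F(x_\alpha,y,x_\alpha)-z_\alpha\in -C$ for all $\alpha$ and $F(x,y,x)-z\in C$; (ii) for every $x\in K$ the map $g(y)=F(x,y,x)$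 is $C$-convex on $K$, i.e. $t\,g(y_1)+(1-t)\,g(y_2)-g(ty_1+(1-t)y_2)\in C$ for all $y_1,y_2\in K$ and $t\in[0,1]$; (iii) $F(x,x,x)\notin-\operatorname{int}C$ for every $x\in K$; (iv) there are a nonempty compact set $K_0\subseteq X$ and a point $y_0\in K$ such that $F(x,y_0,x)\in-\operatorname{int}C$ for all $x\in K\setminus K_0$. Then there exists $x_0\in K$ such that $F(x_0,y,x_0)\notin-\operatorname{int}C$ for all $y\in K$. -/

import Mathlib

open scoped Pointwise Topology

section VectorEquilibrium

universe u v

variable {X : Type u} {Z : Type v} [TopologicalSpace X]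
  [AddCommGroup Z] [Module ℝ Z] [TopologicalSpace Z]

/-- The map `f`, regarded as a map `K → Z`, is `C`-upper semicontinuous at `x`: for every
neighbourhood `V` of `f x` there is a neighbourhood `U` of `x` with `f u ∈ V - C` for all
`u ∈ U ∩ K`. -/
def CUpperSemicontinuousWithinAt (C : PointedCone ℝ Z) (K : Set X) (f : X → Z) (x : X) : Prop :=
  ∀ V ∈ 𝓝 (f x), ∃ U ∈ 𝓝 x, ∀ u ∈ U ∩ K, f u ∈ V - (C : Set Z)

/-- `C`-upper semicontinuity of `f : K → Z` at every point of `K`. -/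
def CUpperSemicontinuousOn (C : PointedCone ℝ Z) (K : Set X) (f : X → Z) : Prop :=
  ∀ x ∈ K, CUpperSemicontinuousWithinAt C K f x

/-- `f : K → Z` is `C`-convex on the (convex) set `K`. -/
def CConvexOn [AddCommGroup X] [Module ℝ X] (C : PointedCone ℝ Z) (K : Set X) (f : X → Z) :
    Prop :=
  ∀ x ∈ K, ∀ y ∈ K, ∀ t ∈ Set.Icc (0 : ℝ) 1,
    t • f x + (1 - t) • f y - f (t • x + (1 - t) • y) ∈ C

/-- For every net in `K` converging to a point `x` of `K`: if `f` takes values outside `-int C`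
along the net, then `f x ∉ -int C`. A net is a family indexed by a nonempty directed preorder
(index sets in the universe of `X` are enough to describe the topology of `X`). -/
def NetStableOutsideNegInterior (C : PointedCone ℝ Z) (K : Set X) (f : X → Z) : Prop :=
  ∀ (ι : Type u) [Preorder ι] [IsDirectedOrder ι] [Nonempty ι] (a : ι → X) (x : X),
    (∀ i, a i ∈ K) → x ∈ K → Filter.Tendsto a Filter.atTop (𝓝 x) →
    (∀ i, f (a i) ∉ -interior (C : Set Z)) → f x ∉ -interior (C : Set Z)

/-- For every net `a` in `K` converging to a point `x` of `K` there is a net `z` in `Z` with the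
same index set, converging to some `z₀`, such that `f (a i) - z i ∈ -C` for all `i` and
`f x - z₀ ∈ C`. -/
def NetUpperMajorized (C : PointedCone ℝ Z) (K : Set X) (f : X → Z) : Prop :=
  ∀ (ι : Type u) [Preorder ι] [IsDirectedOrder ι] [Nonempty ι] (a : ι → X) (x : X),
    (∀ i, a i ∈ K) → x ∈ K → Filter.Tendsto a Filter.atTop (𝓝 x) →
    ∃ (z : ι → Z) (z₀ : Z), Filter.Tendsto z Filter.atTop (𝓝 z₀) ∧
      (∀ i, f (a i) - z i ∈ -(C : Set Z)) ∧ f x - z₀ ∈ C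

end VectorEquilibrium

/-! A solution is a common point of the sets `G y = {x ∈ K | F x y x ∉ -int C}`. Alternatives (b)
and (c) reduce to (a), since `-int C` is open and `-int C - C ⊆ -int C`; (a) makes `G y` closed.
Coercivity puts `G y₀` inside a compact set, so finite intersections suffice. If a convex
combination `x` of finitely many points `y` lay outside `G y` for every `y` of positive weight,
`C`-convexity would give `F x x x ∈ -int C`. This is the KKM condition, and
`exists_mem_forall_mem_of_kkm` applies.

KKM itself is proved combinatorially. Scarf's lemma (`exists_isDominating_image_eq_univ`), a parity
count, is applied to grid points of the simplex ranked by their coordinates and labelled by a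
covering. Refining the grid yields a common point of closed coverings, and a covering built from
distances turns this into KKM. -/

/-! ### Scarf's lemma on dominating sets. -/

section Scarf

open Finset

variable {ι T L : Type*} [LinearOrder L]

/-- `S` is dominating for the family of rankings `u`: no element lies above the minimum of `S` in
every ranking. -/
def IsDominating (u : ι → T → L) (S : Finset T) : Prop :=
  ∀ y, ∃ i, ∀ x ∈ S, u i y ≤ u i x

/-- The elements that lie above the minimum of `R` in every ranking but possibly the `k`-th. -/
def aboveExcept (u : ι → T → L) (R : Finset T) (k : ι) : Set T :=
  {y | ∀ l, l ≠ k → ∃ x ∈ R, u l x < u l y}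

theorem IsDominating.mono {u : ι → T → L} {R S : Finset T} (hS : IsDominating u S) (h : R ⊆ S) :
    IsDominating u R := fun y => (hS y).imp fun _ hi x hx => hi x (h hx)

/-- The count is 0 or 2: if erasing `a` leaves each label but `i₀` exactly once, then `c a` repeats
the label of one other element `b`, and only `a` and `b` can be erased. -/
theorem Finset.even_card_erase_image [Fintype ι] [DecidableEq ι] [DecidableEq T] (c : T → ι)
    (i₀ : ι) (S : Finset T) (hS : S.card = Fintype.card ι) (hc : S.image c ≠ univ) :
    Even {x ∈ S | (S.erase x).image c = univ.erase i₀}.card := by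
  rcases {x ∈ S | (S.erase x).image c = univ.erase i₀}.eq_empty_or_nonempty with h | ⟨a, ha⟩
  · simp [h]
  rw [mem_filter] at ha
  obtain ⟨haS, ha⟩ := ha
  have hcard : ((S.erase a).image c).card = (S.erase a).card := by
    rw [ha, card_erase_of_mem (mem_univ _), card_erase_of_mem haS, hS, card_univ]
  have hinj := card_image_iff.1 hcard
  have hca : c a ∈ univ.erase i₀ := by
    rw [mem_erase]
    refine ⟨fun h => hc ?_, mem_univ _⟩
    rw [← insert_erase haS, image_insert, ha, h, insert_erase (mem_univ _)]
  rw [← ha, mem_image] at hca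
  obtain ⟨b, hb, hab⟩ := hca
  have hbS := mem_of_mem_erase hb
  have hne := ne_of_mem_erase hb
  have : {x ∈ S | (S.erase x).image c = univ.erase i₀} = {a, b} := by
    ext x
    rw [mem_filter, mem_insert, mem_singleton]
    constructor
    · rintro ⟨hx, hxi⟩
      by_contra! h
      have hxc : c x ∈ (S.erase x).image c := by
        rw [hxi, ← ha]
        exact mem_image_of_mem _ (mem_erase.2 ⟨h.1, hx⟩)
      obtain ⟨z, hz, hzx⟩ := mem_image.1 hxc
      have hzS := mem_of_mem_erase hz
      by_cases hza : z = a
      · subst hza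
        exact h.2 (hinj (mem_coe.2 (mem_erase.2 ⟨h.1, hx⟩)) (mem_coe.2 hb)
          (hzx.symm.trans hab.symm))
      · exact ne_of_mem_erase hz (hinj (mem_coe.2 (mem_erase.2 ⟨hza, hzS⟩))
          (mem_coe.2 (mem_erase.2 ⟨h.1, hx⟩)) hzx)
    · rintro (rfl | rfl)
      · exact ⟨haS, ha⟩
      · refine ⟨hbS, ?_⟩
        rw [← ha]
        ext l
        simp only [mem_image, mem_erase]
        constructor
        · rintro ⟨z, ⟨hz, hzS⟩, rfl⟩
          by_cases hza : z = a
          · exact ⟨x, ⟨hne, hbS⟩, by rw [hza, hab]⟩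
          · exact ⟨z, ⟨hza, hzS⟩, rfl⟩
        · rintro ⟨z, ⟨hz, hzS⟩, rfl⟩
          by_cases hzb : z = x
          · exact ⟨a, ⟨hne.symm, haS⟩, by rw [hzb, hab]⟩
          · exact ⟨z, ⟨hzb, hzS⟩, rfl⟩
  rw [this, card_pair hne.symm]
  exact even_two

/-- A dominating set with one element less than the number of rankings extends in exactly two
ways to a dominating set with one more element, unless it lies on the boundary. -/
theorem IsDominating.card_extensions [Fintype ι] [Fintype T] [DecidableEq T]
    {u : ι → T → L} (hu : ∀ i, Function.Injective (u i)) {R : Finset T} (hR : IsDominating u R)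
    (hne : R.Nonempty) (hcard : R.card + 1 = Fintype.card ι)
    (hM : ∀ k, (aboveExcept u R k).Nonempty) [DecidablePred fun x => x ∉ R ∧
      IsDominating u (insert x R)] :
    ({x | x ∉ R ∧ IsDominating u (insert x R)} : Finset T).card = 2 := by
  classical
  choose m hmR hm using fun i => R.exists_min_image (u i) hne
  have hsurj : ∀ x ∈ R, ∃ i, m i = x := fun x hx => by
    obtain ⟨i, hi⟩ := hR x
    exact ⟨i, hu i ((hm i x hx).antisymm (hi _ (hmR i)))⟩
  -- The map `m` sends the rankings onto a set with one element less, so exactly one pair `i`, `j`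
  -- shares its minimizer.
  obtain ⟨i, -, j, -, hij, hmij⟩ := exists_ne_map_eq_of_card_lt_of_maps_to
    (s := (univ : Finset ι)) (t := R) (f := m) (by rw [card_univ]; omega) (fun i _ => hmR i)
  have himg : ∀ k, (k = i ∨ k = j) → ∀ x ∈ R, ∃ l, l ≠ k ∧ m l = x := by
    intro k hk x hx
    obtain ⟨l, rfl⟩ := hsurj x hx
    by_cases hlk : l = k
    · subst hlk
      rcases hk with rfl | rfl
      · exact ⟨j, hij.symm, hmij.symm⟩
      · exact ⟨i, hij, hmij⟩
    · exact ⟨l, hlk, rfl⟩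
  have hinj : Set.InjOn m (univ.erase i : Finset ι) := by
    rw [← card_image_iff]
    have : (univ.erase i).image m = R := by
      ext x
      simp only [mem_image, mem_erase, mem_univ, and_true]
      exact ⟨by rintro ⟨l, -, rfl⟩; exact hmR l, himg i (.inl rfl) x⟩
    rw [this, card_erase_of_mem (mem_univ _), card_univ]
    omega
  have habove : ∀ k y, y ∈ aboveExcept u R k ↔ ∀ l, l ≠ k → u l (m l) < u l y := fun k y =>
    ⟨fun h l hl => by obtain ⟨x, hx, hxy⟩ := h l hl; exact (hm l x hx).trans_lt hxy,
      fun h l hl => ⟨_, hmR l, h l hl⟩⟩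
  have hmax : ∀ k, ∃ x ∈ aboveExcept u R k, ∀ y ∈ aboveExcept u R k, u k y ≤ u k x := fun k =>
    (aboveExcept u R k).exists_max_image (u k) (Set.toFinite _) (hM k)
  choose e he hemax using hmax
  have hroom : ∀ k, (k = i ∨ k = j) → e k ∉ R ∧ IsDominating u (insert (e k) R) := by
    intro k hk
    refine ⟨fun h => ?_, fun y => ?_⟩
    · obtain ⟨l, hl, hle⟩ := himg k hk _ h
      have := (habove k _).1 (he k) l hl
      rw [hle] at this
      exact this.false
    · by_cases hy : ∃ l, l ≠ k ∧ u l y ≤ u l (m l)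
      · obtain ⟨l, hl, hly⟩ := hy
        refine ⟨l, fun x hx => ?_⟩
        rcases mem_insert.1 hx with rfl | hx
        · exact hly.trans ((habove k _).1 (he k) l hl).le
        · exact hly.trans (hm l x hx)
      · push Not at hy
        refine ⟨k, fun x hx => ?_⟩
        rcases mem_insert.1 hx with rfl | hx
        · exact hemax k y ((habove k y).2 hy)
        · obtain ⟨l, hl⟩ := hR y
          by_cases hlk : l = k
          · exact hlk ▸ hl x hx
          · exact absurd (hl _ (hmR l)) (hy l hlk).not_ge
  have hexcl : e i ≠ e j := by
    intro h
    obtain ⟨l, hl⟩ := hR (e i)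
    refine (hl _ (hmR l)).not_gt ?_
    by_cases hli : l = i
    · rw [h]
      exact (habove j _).1 (he j) l (hli ▸ hij)
    · exact (habove i _).1 (he i) l hli
  -- A new element `x` takes over the minimum in some ranking `k`. Every element of `R` must still
  -- be minimal in another ranking, so `k` is one of the pair, and domination forces `x` to be the
  -- maximum `e k`.
  have hall : ∀ x, x ∉ R → IsDominating u (insert x R) → x = e i ∨ x = e j := by
    intro x hx hdom
    obtain ⟨k, hk⟩ := hdom x
    have hkx : ∀ z ∈ R, u k x < u k z := fun z hz =>
      (hk z (mem_insert_of_mem hz)).lt_of_ne fun h => hx (hu k h ▸ hz)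
    have hmin : ∀ z ∈ R, ∃ l, l ≠ k ∧ z = m l ∧ u l z < u l x := by
      intro z hz
      obtain ⟨l, hl⟩ := hdom z
      have hlk : l ≠ k := by
        rintro rfl
        exact (hkx z hz).not_ge (hl x (mem_insert_self _ _))
      exact ⟨l, hlk, hu l ((hl _ (mem_insert_of_mem (hmR l))).antisymm (hm l z hz)),
        (hl x (mem_insert_self _ _)).lt_of_ne fun h => hx (hu l h ▸ hz)⟩
    have hkij : k = i ∨ k = j := by
      by_contra! h
      obtain ⟨l, hlk, hl, -⟩ := hmin _ (hmR k)
      by_cases hli : l = i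
      · have : m k = m j := by rw [hl, hli, hmij]
        exact h.2 (hinj (by simp [h.1]) (by simp [hij.symm]) this)
      · exact hlk (hinj (by simp [hli]) (by simp [h.1]) hl.symm)
    have hinjk : ∀ l l', l ≠ k → l' ≠ k → m l = m l' → l = l' := by
      intro l l' hl hl' h
      rcases hkij with rfl | rfl
      · exact hinj (by simp [hl]) (by simp [hl']) h
      · by_cases h1 : l = i
        · by_cases h2 : l' = i
          · rw [h1, h2]
          · exact absurd (hinj (by simp [hij.symm]) (by simp [h2])
              (by rw [← hmij, ← h1, h])) (Ne.symm hl')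
        · by_cases h2 : l' = i
          · exact absurd (hinj (by simp [hij.symm]) (by simp [h1])
              (by rw [← hmij, ← h2, h])) (Ne.symm hl)
          · exact hinj (by simp [h1]) (by simp [h2]) h
    have hxM : x ∈ aboveExcept u R k := by
      rw [habove]
      intro l hl
      obtain ⟨l', hl', h, hlt⟩ := hmin _ (hmR l)
      have := hinjk _ _ hl hl' h
      rwa [← this] at hlt
    have hxe : x = e k := by
      refine hu k ((hemax k x hxM).antisymm ?_)
      obtain ⟨l, hl⟩ := hdom (e k)
      by_cases hlk : l = k
      · exact hlk ▸ hl x (mem_insert_self _ _)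
      · exact absurd (hl _ (mem_insert_of_mem (hmR l))) ((habove k _).1 (he k) l hlk).not_ge
    rcases hkij with rfl | rfl
    · exact .inl hxe
    · exact .inr hxe
  have : ({x | x ∉ R ∧ IsDominating u (insert x R)} : Finset T) = {e i, e j} := by
    ext x
    simp only [mem_filter, mem_univ, true_and, mem_insert, mem_singleton]
    constructor
    · exact fun h => hall x h.1 h.2
    · rintro (rfl | rfl)
      · exact hroom i (.inl rfl)
      · exact hroom j (.inr rfl)
  rw [this, card_pair hexcl]

/-- **Scarf's lemma** on dominating sets of a finite set with finitely many rankings and a slack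
element for each of them. -/
theorem exists_isDominating_image_eq_univ [Fintype ι] [DecidableEq ι] [Nontrivial ι] [Fintype T]
    [DecidableEq T] {u : ι → T → L} (hu : ∀ i, Function.Injective (u i)) (s : ι → T)
    (hs : Function.Injective s) (hbot : ∀ i y, y ≠ s i → u i (s i) < u i y)
    (htop : ∀ i j y, j ≠ i → y ∉ Set.range s → u i y < u i (s j))
    (c : T → ι) (hc : ∀ i, c (s i) = i) :
    ∃ S : Finset T, S.card = Fintype.card ι ∧ IsDominating u S ∧ S.image c = univ := by
  classical
  by_contra! hno
  obtain ⟨i₀⟩ : Nonempty ι := inferInstance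
  -- Double counting: grouped by `S`, the pairs are even in number if no `S` carries all labels;
  -- grouped by `S.erase x`, they are odd in number, because only the boundary set `R₀` has a single
  -- extension.
  let P : Finset (Finset T × T) := {q | q.2 ∈ q.1 ∧ q.1.card = Fintype.card ι ∧
    IsDominating u q.1 ∧ (q.1.erase q.2).image c = univ.erase i₀}
  have heven : Even P.card := by
    rw [card_eq_sum_card_fiberwise (f := Prod.fst) (t := univ) (fun _ _ => mem_coe.2 (mem_univ _))]
    refine even_sum _ fun S _ => ?_
    by_cases hS : S.card = Fintype.card ι ∧ IsDominating u S
    · have h := even_card_erase_image c i₀ S hS.1 (hno S hS.1 hS.2)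
      refine (congrArg Even ?_).mpr h
      refine card_nbij' Prod.snd (fun x => (S, x)) ?_ ?_ ?_ ?_
      · rintro ⟨S', x⟩ hx
        simp [P] at hx ⊢
        obtain ⟨hx, rfl⟩ := hx
        exact ⟨hx.1, hx.2.2.2⟩
      · intro x h
        simp [P] at h ⊢
        exact ⟨h.1, hS.1, hS.2, h.2⟩
      · rintro ⟨S', x⟩ h
        simp [P] at h ⊢
        exact h.2.symm
      · intro x _
        rfl
    · have : {q ∈ P | q.1 = S} = ∅ := by
        refine filter_eq_empty_iff.2 fun q hq h => hS ?_
        subst h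
        simp only [P, mem_filter] at hq
        exact ⟨hq.2.2.1, hq.2.2.2.1⟩
      simp [this]
  have hfib : ∀ R : Finset T, R.card + 1 = Fintype.card ι → R.image c = univ.erase i₀ →
      {q ∈ P | q.1.erase q.2 = R}.card =
        ({x | x ∉ R ∧ IsDominating u (insert x R)} : Finset T).card := by
    intro R hR hRc
    refine card_nbij' Prod.snd (fun x => (insert x R, x)) ?_ ?_ ?_ ?_
    · rintro ⟨S, x⟩ h
      simp [P] at h ⊢
      obtain ⟨h, rfl⟩ := h
      simp [insert_erase h.1, h.2.2.1]
    · intro x h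
      simp [P] at h ⊢
      refine ⟨⟨?_, h.2, ?_⟩, h.1⟩
      · rw [card_insert_of_notMem h.1, hR]
      · rwa [erase_eq_of_notMem h.1]
    · rintro ⟨S, x⟩ h
      simp [P] at h ⊢
      obtain ⟨h, rfl⟩ := h
      exact insert_erase h.1
    · intro x _
      rfl
  have hcardP : ∀ q ∈ P, (q.1.erase q.2).card + 1 = Fintype.card ι := by
    intro q hq
    simp only [P, mem_filter] at hq
    rw [card_erase_add_one hq.2.1, hq.2.2.1]
  let R₀ : Finset T := (univ.erase i₀).image s
  have hR₀card : R₀.card + 1 = Fintype.card ι := by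
    rw [card_image_of_injective _ hs, card_erase_add_one (mem_univ _), card_univ]
  have hR₀c : R₀.image c = univ.erase i₀ := by
    rw [image_image, show c ∘ s = id from funext hc, image_id]
  have hR₀mem : ∀ y, y ∈ R₀ ↔ ∃ i, i ≠ i₀ ∧ s i = y := by simp [R₀]
  have hone : {q ∈ P | q.1.erase q.2 = R₀}.card = 1 := by
    rw [hfib R₀ hR₀card hR₀c, card_eq_one]
    have hdom : ∀ x, x ∉ R₀ → (IsDominating u (insert x R₀) ↔ ∀ y, y ∉ R₀ → u i₀ y ≤ u i₀ x) := by
      intro x hx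
      constructor
      · intro h y hy
        by_cases hy0 : y = s i₀
        · by_cases hxy : x = y
          · rw [hxy]
          · rw [hy0] at hxy ⊢
            exact (hbot _ _ hxy).le
        · have hys : y ∉ Set.range s := by
            rintro ⟨i, rfl⟩
            exact hy ((hR₀mem _).2 ⟨i, fun h => hy0 (h ▸ rfl), rfl⟩)
          obtain ⟨i, hi⟩ := h y
          by_cases hii : i = i₀
          · subst hii
            exact hi x (mem_insert_self _ _)
          · exact absurd (hi (s i) (mem_insert_of_mem ((hR₀mem _).2 ⟨i, hii, rfl⟩)))
              (hbot i y fun h => hys ⟨i, h.symm⟩).not_ge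
      · intro h y
        by_cases hys : y ∈ Set.range s
        · obtain ⟨i, rfl⟩ := hys
          refine ⟨i, fun z _ => ?_⟩
          by_cases hz : z = s i
          · rw [hz]
          · exact (hbot i z hz).le
        · have hy : y ∉ R₀ := fun hy => by
            obtain ⟨i, -, h⟩ := (hR₀mem _).1 hy
            exact hys ⟨i, h⟩
          refine ⟨i₀, fun z hz => ?_⟩
          rcases mem_insert.1 hz with rfl | hz
          · exact h y hy
          · obtain ⟨i, hi, rfl⟩ := (hR₀mem _).1 hz
            exact (htop i₀ i y hi hys).le
    have hs0 : s i₀ ∉ R₀ := fun h => by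
      obtain ⟨i, hi, h⟩ := (hR₀mem _).1 h
      exact hi (hs h)
    obtain ⟨e, he, hemax⟩ := (R₀ᶜ).exists_max_image (u i₀) ⟨s i₀, by simpa using hs0⟩
    rw [mem_compl] at he
    refine ⟨e, ?_⟩
    ext x
    simp only [mem_filter, mem_univ, true_and, mem_singleton]
    constructor
    · rintro ⟨hx, h⟩
      exact hu i₀ ((hemax x (mem_compl.2 hx)).antisymm ((hdom x hx).1 h e he))
    · rintro rfl
      exact ⟨he, (hdom x he).2 fun y hy => hemax y (mem_compl.2 hy)⟩
  have hodd : Odd P.card := by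
    rw [card_eq_sum_card_fiberwise (f := fun q => q.1.erase q.2) (t := univ)
      (fun _ _ => mem_coe.2 (mem_univ _)), ← add_sum_erase _ _ (mem_univ R₀), hone]
    refine odd_one.add_even (even_sum _ fun R hR => ?_)
    have hRne := ne_of_mem_erase hR
    by_cases hRP : R.card + 1 = Fintype.card ι ∧ R.image c = univ.erase i₀
    swap
    · have : {q ∈ P | q.1.erase q.2 = R} = ∅ := by
        refine filter_eq_empty_iff.2 fun q hq h => hRP ?_
        subst h
        refine ⟨hcardP q hq, ?_⟩
        simp only [P, mem_filter] at hq
        exact hq.2.2.2.2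
      simp [this]
    obtain ⟨hcard, hRc⟩ := hRP
    rw [hfib R hcard hRc]
    by_cases hR : IsDominating u R
    swap
    · have : ({x | x ∉ R ∧ IsDominating u (insert x R)} : Finset T) = ∅ :=
        filter_eq_empty_iff.2 fun x _ h => hR (h.2.mono (subset_insert _ _))
      simp [this]
    have hne : R.Nonempty := by
      rw [← card_pos]
      have := Fintype.one_lt_card (α := ι)
      omega
    rw [hR.card_extensions hu hne hcard]
    · exact even_two
    intro k
    -- The slack `s k` is a witness unless `R` consists of all slacks but `s l`; its labels would
    -- then give `l = i₀`, that is `R = R₀`.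
    refine ⟨s k, fun l hl => ?_⟩
    by_contra! h
    have hsub : R ⊆ (univ.erase l).image s := by
      intro x hx
      have hxs : x ∈ Set.range s := by
        by_contra hxs
        exact (htop l k x hl.symm hxs).not_ge (h x hx)
      obtain ⟨i, rfl⟩ := hxs
      refine mem_image_of_mem _ (mem_erase.2 ⟨?_, mem_univ _⟩)
      rintro rfl
      exact (hbot i (s k) fun h => hl (hs h).symm).not_ge (h _ hx)
    have heq : R = (univ.erase l).image s := by
      refine eq_of_subset_of_card_le hsub ?_
      rw [card_image_of_injective _ hs, card_erase_of_mem (mem_univ _), card_univ]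
      omega
    have hl0 : l = i₀ := by
      have : (univ.erase l : Finset ι) = univ.erase i₀ := by
        rw [← hRc, heq, image_image, show c ∘ s = id from funext hc, image_id]
      by_contra hne
      have hmem : l ∈ univ.erase i₀ := mem_erase.2 ⟨hne, mem_univ _⟩
      rw [← this] at hmem
      exact notMem_erase _ _ hmem
    exact hRne (by rw [heq, hl0])
  exact Nat.not_even_iff_odd.2 hodd heven

/-- Scarf's lemma for integer-valued, possibly non-injective, rankings. -/
theorem exists_dominating_labelled_family [Fintype ι] [Nontrivial ι] [Finite T] [Nonempty T]
    (v : ι → T → ℤ) (c : T → ι) :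
    ∃ (C : Finset ι) (p : ι → T), (∀ i ∈ C, c (p i) = i) ∧
      ∀ y, ∃ i ∈ C, ∀ j ∈ C, v i y ≤ v i (p j) := by
  classical
  have := Fintype.ofFinite T
  let e := Fintype.equivFin (T ⊕ ι)
  -- The slack of `i` is lowest in ranking `i` and highest in the others; the enumeration `e` breaks
  -- ties.
  let w : ι → T ⊕ ι → WithBot (WithTop ℤ) := fun i =>
    Sum.elim (fun x => ((v i x : WithTop ℤ) : WithBot (WithTop ℤ))) fun j => if j = i then ⊥ else ⊤
  let u : ι → T ⊕ ι → WithBot (WithTop ℤ) ×ₗ Fin (Fintype.card (T ⊕ ι)) := fun i t =>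
    toLex (w i t, e t)
  have hlt : ∀ i s t, w i s < w i t → u i s < u i t := fun i s t h => Prod.Lex.toLex_lt_toLex.2 (.inl h)
  have hle : ∀ i s t, u i s ≤ u i t → w i s ≤ w i t := fun i s t h =>
    le_of_not_gt fun h' => (hlt i t s h').not_ge h
  obtain ⟨S, -, hdom, hSc⟩ := exists_isDominating_image_eq_univ (u := u)
    (fun i s t h => e.injective (congrArg Prod.snd (toLex.injective h))) Sum.inr Sum.inr_injective
    (fun i y hy => hlt _ _ _ (by
      rcases y with x | j
      · simp [w]
      · have hji : j ≠ i := fun h => hy (h ▸ rfl)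
        simp [w, hji]))
    (fun i j y hj hy => hlt _ _ _ (by
      rcases y with x | k
      · simp only [w, Sum.elim_inl, Sum.elim_inr, if_neg hj]
        exact WithBot.coe_lt_coe.2 (WithTop.coe_lt_top _)
      · exact absurd ⟨k, rfl⟩ hy)) (Sum.elim c id) (fun _ => rfl)
  have hp : ∀ i, ∃ x, Sum.inr i ∉ S → Sum.inl x ∈ S ∧ c x = i := by
    intro i
    by_cases hi : Sum.inr i ∈ S
    · exact ⟨Classical.arbitrary T, fun h => absurd hi h⟩
    · have : i ∈ S.image (Sum.elim c id) := hSc ▸ mem_univ i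
      obtain ⟨x | j, ht, h⟩ := mem_image.1 this
      · exact ⟨x, fun _ => ⟨ht, h⟩⟩
      · exact absurd (show j = i from h) fun h => hi (h ▸ ht)
  choose p hp using hp
  refine ⟨univ.filter fun i => Sum.inr i ∉ S, p, fun i hi => (hp i (by simpa using hi)).2,
    fun y => ?_⟩
  obtain ⟨i, hi⟩ := hdom (Sum.inl y)
  refine ⟨i, ?_, fun j hj => ?_⟩
  · rw [mem_filter]
    -- If the slack of `i` were in `S`, its value `⊥` would bound the integer `v i y` from above.
    refine ⟨mem_univ _, fun h => ?_⟩
    have := hle _ _ _ (hi _ h)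
    simp [w] at this
  · have := hle _ _ _ (hi _ (hp j (by simpa using hj)).1)
    simpa [w] using this

end Scarf

/-! ### From Scarf's lemma to the KKM principle. -/

section KKM

open Filter

variable {ι : Type*} [Fintype ι]

/-- Points of the simplex that are approximately in all members of a labelled covering. -/
theorem exists_approx_common_point_of_simplex_covering [Nontrivial ι] {A : ι → Set (ι → ℝ)}
    (hcov : ∀ x ∈ stdSimplex ℝ ι, ∃ i, x ∈ A i) {N : ℕ} (hN : 0 < N) :
    ∃ x ∈ stdSimplex ℝ ι, ∀ i, ∃ z ∈ stdSimplex ℝ ι, dist z x ≤ Fintype.card ι / N ∧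
      (z ∈ A i ∨ z i ≤ Fintype.card ι / N) := by
  classical
  let n := Fintype.card ι
  let T := {x : ι → Fin (N + 1) // ∑ i, (x i : ℕ) = N}
  have hNR : (0 : ℝ) < N := by exact_mod_cast hN
  let g : T → ι → ℝ := fun x i => (x.1 i : ℕ) / N
  have hg : ∀ x, g x ∈ stdSimplex ℝ ι := fun x => by
    refine ⟨fun i => by positivity, ?_⟩
    simp only [g]
    rw [← Finset.sum_div, div_eq_one_iff_eq hNR.ne']
    exact_mod_cast x.2
  have hmk : ∀ y : ι → ℕ, ∑ i, y i = N → ∃ x : T, ∀ i, (x.1 i : ℕ) = y i := fun y hy =>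
    ⟨⟨fun i => ⟨y i, Nat.lt_succ_of_le (hy ▸ Finset.single_le_sum (fun _ _ => Nat.zero_le _)
      (Finset.mem_univ i))⟩, hy⟩, fun _ => rfl⟩
  have hinc : ∀ y : ι → ℕ, ∑ i, y i ≤ N → ∃ x : T, ∀ i, y i ≤ (x.1 i : ℕ) := by
    intro y hy
    obtain ⟨a⟩ : Nonempty ι := inferInstance
    obtain ⟨x, hx⟩ := hmk (y + Pi.single a (N - ∑ i, y i)) (by
      simp only [Pi.add_apply, Finset.sum_add_distrib, Finset.sum_pi_single', Finset.mem_univ,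
        if_true]
      omega)
    exact ⟨x, fun i => by rw [hx]; simp⟩
  obtain ⟨x₀, -⟩ := hinc 0 (by simp)
  have : Nonempty T := ⟨x₀⟩
  choose c hc using fun x : T => hcov (g x) (hg x)
  obtain ⟨C, p, hp, hdom⟩ := exists_dominating_labelled_family
    (fun i (x : T) => ((x.1 i : ℕ) : ℤ)) c
  simp only [Nat.cast_le] at hdom
  obtain ⟨a, ha, -⟩ := hdom x₀
  choose q hqC hq using fun i => C.exists_min_image (fun j => ((p j).1 i : ℕ)) ⟨a, ha⟩
  let m : ι → ℕ := fun i => if i ∈ C then ((p (q i)).1 i : ℕ) else 0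
  have hm : ∀ j ∈ C, ∀ i, m i ≤ ((p j).1 i : ℕ) := by
    intro j hj i
    by_cases hi : i ∈ C
    · simp only [m, if_pos hi]
      exact hq i j hj
    · simp [m, hi]
  -- Otherwise some grid point exceeds `m` in every coordinate, against domination. Hence `m` has
  -- sum above `N - n`, and the chosen points, all above `m`, are within `n` of it.
  have hsum : N < ∑ i, (m i + 1) := by
    by_contra! h
    obtain ⟨y, hy⟩ := hinc (fun i => m i + 1) h
    obtain ⟨i, hi, hle⟩ := hdom y
    have h1 := hle (q i) (hqC i)
    have h2 := hy i
    simp only [m, if_pos hi] at h2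
    omega
  rw [Finset.sum_add_distrib, Finset.sum_const, smul_eq_mul, mul_one, Finset.card_univ] at hsum
  have hub : ∀ j ∈ C, ∀ i, ((p j).1 i : ℕ) ≤ m i + n := by
    intro j hj i
    have h1 : ∑ l ∈ Finset.univ.erase i, m l ≤ ∑ l ∈ Finset.univ.erase i, ((p j).1 l : ℕ) :=
      Finset.sum_le_sum fun l _ => hm j hj l
    have h2 := Finset.add_sum_erase Finset.univ m (Finset.mem_univ i)
    have h3 := Finset.add_sum_erase Finset.univ (fun l => ((p j).1 l : ℕ)) (Finset.mem_univ i)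
    have h4 := (p j).2
    simp only [n]
    omega
  have hdist : ∀ j ∈ C, dist (g (p j)) (g (p a)) ≤ n / N := by
    intro j hj
    refine (dist_pi_le_iff (by positivity)).2 fun i => ?_
    have h1 := hm j hj i
    have h2 := hub j hj i
    have h3 := hm a ha i
    have h4 := hub a ha i
    simp only [g]
    rw [Real.dist_eq, ← sub_div, abs_div, abs_of_pos hNR]
    refine div_le_div_of_nonneg_right (abs_sub_le_iff.2 ⟨?_, ?_⟩) hNR.le
    · rw [sub_le_iff_le_add]
      exact_mod_cast (by omega : ((p j).1 i : ℕ) ≤ n + ((p a).1 i : ℕ))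
    · rw [sub_le_iff_le_add]
      exact_mod_cast (by omega : ((p a).1 i : ℕ) ≤ n + ((p j).1 i : ℕ))
  refine ⟨g (p a), hg _, fun i => ?_⟩
  by_cases hi : i ∈ C
  · refine ⟨g (p i), hg _, hdist i hi, .inl ?_⟩
    have := hc (p i)
    rwa [hp i hi] at this
  · refine ⟨g (p a), hg _, by rw [dist_self]; positivity, .inr ?_⟩
    have h := hub a ha i
    simp only [m, if_neg hi, zero_add] at h
    exact div_le_div_of_nonneg_right (by exact_mod_cast h) hNR.le

/-- If closed sets `A i` cover the standard simplex and each `A i` contains the facet `x i = 0`,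
then they have a common point in the simplex. -/
theorem exists_mem_stdSimplex_forall_mem_of_facet_subset [Nonempty ι] {A : ι → Set (ι → ℝ)}
    (hA : ∀ i, IsClosed (A i)) (hcov : ∀ x ∈ stdSimplex ℝ ι, ∃ i, x ∈ A i)
    (hfacet : ∀ x ∈ stdSimplex ℝ ι, ∀ i, x i = 0 → x ∈ A i) :
    ∃ x ∈ stdSimplex ℝ ι, ∀ i, x ∈ A i := by
  classical
  cases subsingleton_or_nontrivial ι with
  | inl h =>
    obtain ⟨a⟩ : Nonempty ι := inferInstance
    obtain ⟨i, hi⟩ := hcov _ (single_mem_stdSimplex ℝ a)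
    exact ⟨_, single_mem_stdSimplex ℝ a, fun j => Subsingleton.elim i j ▸ hi⟩
  | inr h =>
    choose x hx z hz hzx hzA using fun N : ℕ =>
      exists_approx_common_point_of_simplex_covering hcov N.succ_pos
    obtain ⟨y, hy, φ, hφ, hlim⟩ := (isCompact_stdSimplex ℝ ι).tendsto_subseq hx
    have hε : Tendsto (fun k => (Fintype.card ι : ℝ) / ((φ k).succ : ℕ)) atTop (𝓝 0) :=
      ((tendsto_const_div_atTop_nhds_zero_nat (Fintype.card ι : ℝ)).comp
        (tendsto_add_atTop_nat 1)).comp hφ.tendsto_atTop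
    refine ⟨y, hy, fun i => ?_⟩
    have hzlim : Tendsto (fun k => z (φ k) i) atTop (𝓝 y) := by
      refine (tendsto_iff_of_dist ?_).2 hlim
      exact squeeze_zero (fun _ => dist_nonneg) (fun k => hzx (φ k) i) hε
    by_cases hfreq : ∃ᶠ k in atTop, z (φ k) i ∈ A i
    · exact (hA i).mem_of_frequently_of_tendsto hfreq hzlim
    · refine hfacet y hy i (le_antisymm ?_ (hy.1 i))
      refine le_of_tendsto_of_tendsto ((continuous_apply i).continuousAt.tendsto.comp hzlim) hε ?_
      filter_upwards [not_frequently.1 hfreq] with k hk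
      exact (hzA (φ k) i).resolve_left hk

/-- The **Knaster–Kuratowski–Mazurkiewicz lemma** for the standard simplex. -/
theorem exists_mem_stdSimplex_forall_mem_of_kkm [Nonempty ι] {G : ι → Set (ι → ℝ)}
    (hG : ∀ i, IsClosed (G i)) (hkkm : ∀ x ∈ stdSimplex ℝ ι, ∃ i, 0 < x i ∧ x ∈ G i) :
    ∃ x ∈ stdSimplex ℝ ι, ∀ i, x ∈ G i := by
  classical
  -- Needed because `infDist` to the empty set is 0.
  have hne : ∀ i, (G i).Nonempty := by
    intro i
    obtain ⟨j, hj, hmem⟩ := hkkm _ (single_mem_stdSimplex ℝ i)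
    by_cases hji : j = i
    · exact ⟨_, hji ▸ hmem⟩
    · simp [hji] at hj
  have hcont : ∀ i, Continuous fun x => Metric.infDist x (G i) := fun i =>
    Metric.continuous_infDist_pt _
  -- These sets cover since the weights `x i` sum to 1. At a common point, an `i` with `0 < x i` and
  -- `x ∈ G i` makes the sum of the distances vanish.
  obtain ⟨x, hx, hmem⟩ := exists_mem_stdSimplex_forall_mem_of_facet_subset
    (A := fun i => {x | x i * ∑ j, Metric.infDist x (G j) ≤ Metric.infDist x (G i)})
    (fun i => isClosed_le ((continuous_apply i).mul (continuous_finsetSum _ fun j _ => hcont j))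
      (hcont i))
    (fun x hx => by
      by_contra! h
      simp only [Set.mem_ofPred_eq, not_le] at h
      have := Finset.sum_lt_sum_of_nonempty (s := Finset.univ) Finset.univ_nonempty
        fun i _ => h i
      rw [← Finset.sum_mul, hx.2, one_mul] at this
      exact this.false)
    (fun x _ i hi => by
      simp only [Set.mem_ofPred_eq, hi, zero_mul]
      exact Metric.infDist_nonneg)
  obtain ⟨i, hi, hxi⟩ := hkkm x hx
  have hle := hmem i
  simp only [Set.mem_ofPred_eq, Metric.infDist_zero_of_mem hxi] at hle
  have hnonneg : ∀ j ∈ Finset.univ, 0 ≤ Metric.infDist x (G j) := fun _ _ => Metric.infDist_nonneg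
  have hsum : ∑ j, Metric.infDist x (G j) = 0 :=
    le_antisymm (nonpos_of_mul_nonpos_right hle hi) (Finset.sum_nonneg hnonneg)
  refine ⟨x, hx, fun j => ((hG j).mem_iff_infDist_zero (hne j)).2 ?_⟩
  exact (Finset.sum_eq_zero_iff_of_nonneg hnonneg).1 hsum j (Finset.mem_univ j)

/-- The KKM principle for finitely many points of a topological vector space. -/
theorem exists_mem_forall_mem_of_kkm {X : Type*} [AddCommGroup X] [Module ℝ X]
    [TopologicalSpace X] [IsTopologicalAddGroup X] [ContinuousSMul ℝ X] [Nonempty ι] (y : ι → X)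
    {G : ι → Set X} (hG : ∀ i, IsClosed (G i))
    (hkkm : ∀ w ∈ stdSimplex ℝ ι, ∃ i, 0 < w i ∧ ∑ j, w j • y j ∈ G i) :
    ∃ x, ∀ i, x ∈ G i := by
  have hcont : Continuous fun w : ι → ℝ => ∑ j, w j • y j := by fun_prop
  obtain ⟨w, -, hw⟩ := exists_mem_stdSimplex_forall_mem_of_kkm
    (G := fun i => (fun w : ι → ℝ => ∑ j, w j • y j) ⁻¹' G i)
    (fun i => (hG i).preimage hcont) hkkm
  exact ⟨_, hw⟩

end KKM

/-! ### Closedness and convexity relative to the cone. -/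

section VectorEquilibriumProof

universe u v

variable {X : Type u} {Z : Type v} [TopologicalSpace X]
  [AddCommGroup Z] [Module ℝ Z] [TopologicalSpace Z]

/-- A closure point is the limit of a net indexed by its own neighbourhoods under reverse inclusion.
-/
theorem NetStableOutsideNegInterior.isClosed {C : PointedCone ℝ Z} {K : Set X} {f : X → Z}
    (h : NetStableOutsideNegInterior C K f) (hK : IsClosed K) :
    IsClosed {x ∈ K | f x ∉ -interior (C : Set Z)} := by
  refine isClosed_of_closure_subset fun x hx => ?_
  have hxK : x ∈ K := closure_minimal (fun y hy => hy.1) hK hx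
  rw [mem_closure_iff_nhds] at hx
  let I := {V : Set X // V ∈ 𝓝 x}ᵒᵈ
  choose a haV ha using fun V : I => hx (OrderDual.ofDual V).1 (OrderDual.ofDual V).2
  have : IsDirectedOrder I := ⟨fun V W =>
    ⟨OrderDual.toDual ⟨_, Filter.inter_mem (OrderDual.ofDual V).2 (OrderDual.ofDual W).2⟩,
      Set.inter_subset_left, Set.inter_subset_right⟩⟩
  have : Nonempty I := ⟨OrderDual.toDual ⟨_, Filter.univ_mem⟩⟩
  refine ⟨hxK, h I a x (fun V => (ha V).1) hxK (fun V hV => ?_) fun V => (ha V).2⟩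
  exact Filter.mem_map.2 (Filter.mem_atTop_sets.2
    ⟨OrderDual.toDual ⟨V, hV⟩, fun W hW => hW (haV W)⟩)

variable [IsTopologicalAddGroup Z]

/-- `int C + C` is an open subset of `C`, hence lies in `int C`. -/
theorem PointedCone.sub_mem_neg_interior {C : PointedCone ℝ Z} {a b : Z}
    (ha : a ∈ -interior (C : Set Z)) (hb : b ∈ C) : a - b ∈ -interior (C : Set Z) := by
  rw [Set.mem_neg] at ha ⊢
  have h : interior (C : Set Z) + (C : Set Z) ⊆ interior (C : Set Z) :=
    subset_interior_add_left.trans (interior_mono (by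
      rintro _ ⟨x, hx, y, hy, rfl⟩
      exact C.add_mem hx hy))
  rw [neg_sub, sub_eq_neg_add]
  exact h (Set.add_mem_add ha hb)

theorem CUpperSemicontinuousOn.netStableOutsideNegInterior {C : PointedCone ℝ Z} {K : Set X}
    {f : X → Z} (h : CUpperSemicontinuousOn C K f) : NetStableOutsideNegInterior C K f := by
  intro I _ _ _ a x haK hxK ha hout hx
  obtain ⟨U, hU, hsub⟩ := h x hxK _ (isOpen_interior.neg.mem_nhds hx)
  obtain ⟨i, hi⟩ := (ha.eventually hU).exists
  obtain ⟨p, hp, q, hq, hpq⟩ := hsub (a i) ⟨hi, haK i⟩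
  exact hout i (hpq ▸ PointedCone.sub_mem_neg_interior hp hq)

theorem NetUpperMajorized.netStableOutsideNegInterior {C : PointedCone ℝ Z} {K : Set X}
    {f : X → Z} (h : NetUpperMajorized C K f) : NetStableOutsideNegInterior C K f := by
  intro I _ _ _ a x haK hxK ha hout hx
  obtain ⟨z, z₀, hz, hle, hz₀⟩ := h I a x haK hxK ha
  have hz₀' : z₀ ∈ -interior (C : Set Z) := by
    simpa using PointedCone.sub_mem_neg_interior hx hz₀
  obtain ⟨i, hi⟩ := (hz.eventually (isOpen_interior.neg.mem_nhds hz₀')).exists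
  refine hout i ?_
  have := PointedCone.sub_mem_neg_interior hi (hle i : -(f (a i) - z i) ∈ C)
  simpa using this

theorem CConvexOn.convex_setOf_mem_neg_interior [ContinuousConstSMul ℝ Z] {E : Type*}
    [AddCommGroup E] [Module ℝ E] {C : PointedCone ℝ Z} {K : Set E} (hK : Convex ℝ K) {g : E → Z}
    (hg : CConvexOn C K g) : Convex ℝ {y ∈ K | g y ∈ -interior (C : Set Z)} := by
  have hC : Convex ℝ (-interior (C : Set Z)) := (C : ConvexCone ℝ Z).convex.interior.neg
  intro x hx y hy s t hs ht hst
  refine ⟨hK hx.1 hy.1 hs ht hst, ?_⟩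
  obtain rfl : t = 1 - s := by linarith
  have := PointedCone.sub_mem_neg_interior (hC hx.2 hy.2 hs ht hst)
    (hg x hx.1 y hy.1 s ⟨hs, by linarith⟩)
  simpa using this

end VectorEquilibriumProof

theorem theorem3p3 {X : Type*} {Z : Type*}
    [AddCommGroup X] [Module ℝ X] [TopologicalSpace X] [IsTopologicalAddGroup X]
    [ContinuousSMul ℝ X] [T2Space X]
    [AddCommGroup Z] [Module ℝ Z] [TopologicalSpace Z] [IsTopologicalAddGroup Z]
    [ContinuousSMul ℝ Z] [T2Space Z]
    (C : PointedCone ℝ Z) (hCpointed : (C : Set Z) ∩ -(C : Set Z) = {0})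
    (hCint : (interior (C : Set Z)).Nonempty)
    (K : Set X) (hKne : K.Nonempty) (hKconv : Convex ℝ K) (hKclosed : IsClosed K)
    (F : X → X → X → Z)
    (hi : ∀ y ∈ K,
      NetStableOutsideNegInterior C K (fun x => F x y x) ∨
      CUpperSemicontinuousOn C K (fun x => F x y x) ∨
      NetUpperMajorized C K (fun x => F x y x))
    (hii : ∀ x ∈ K, CConvexOn C K (fun y => F x y x))
    (hiii : ∀ x ∈ K, F x x x ∉ -interior (C : Set Z))
    (hiv : ∃ K₀ : Set X, K₀.Nonempty ∧ IsCompact K₀ ∧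
      ∃ y₀ ∈ K, ∀ x ∈ K \ K₀, F x y₀ x ∈ -interior (C : Set Z)) :
    ∃ x₀ ∈ K, ∀ y ∈ K, F x₀ y x₀ ∉ -interior (C : Set Z) := by
  obtain ⟨K₀, -, hK₀, y₀, hy₀, hcoer⟩ := hiv
  let G : K → Set X := fun y => {x ∈ K | F x y x ∉ -interior (C : Set Z)}
  have hG : ∀ y, IsClosed (G y) := by
    intro y
    have : NetStableOutsideNegInterior C K fun x => F x y x := by
      rcases hi y y.2 with h | h | h
      · exact h
      · exact h.netStableOutsideNegInterior
      · exact h.netStableOutsideNegInterior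
    exact this.isClosed hKclosed
  have hcomp : IsCompact (G ⟨y₀, hy₀⟩) := hK₀.of_isClosed_subset (hG _) fun x hx => by
    by_contra h
    exact hx.2 (hcoer x ⟨hx.1, h⟩)
  obtain ⟨x₀, hx₀, hmem⟩ := hcomp.inter_iInter_nonempty G hG fun s => by
    -- Adjoining `y₀` as `none` makes the family nonempty and puts the common point in the compact
    -- set.
    let y : Option s → K := fun o => o.elim ⟨y₀, hy₀⟩ Subtype.val
    obtain ⟨x, hx⟩ := exists_mem_forall_mem_of_kkm (fun o => (y o : X)) (fun o => hG (y o))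
      fun w hw => by
        by_contra! h
        have hxK : ∑ o, w o • (y o : X) ∈ K :=
          hKconv.sum_mem (fun o _ => hw.1 o) hw.2 fun o _ => (y o).2
        set x := ∑ o, w o • (y o : X) with hx
        have hconv := (hii x hxK).convex_setOf_mem_neg_interior hKconv
        classical
        -- Zero weights are dropped because `h` speaks only of positive ones.
        have hsub : ∑ o ∈ Finset.univ.filter (fun o => w o ≠ 0), w o • (y o : X) = x :=
          Finset.sum_filter_of_ne fun o _ ho h => ho (by rw [h, zero_smul])
        have hmem := hconv.sum_mem (t := Finset.univ.filter fun o => w o ≠ 0)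
          (fun o _ => hw.1 o) ((Finset.sum_filter_ne_zero _).trans hw.2)
          (z := fun o => (y o : X)) fun o ho => by
            refine ⟨(y o).2, ?_⟩
            by_contra hout
            exact h o ((hw.1 o).lt_of_ne' (Finset.mem_filter.1 ho).2) ⟨hxK, hout⟩
        rw [hsub] at hmem
        exact hiii x hxK hmem.2
    exact ⟨x, hx none, Set.mem_iInter₂.2 fun i hi => hx (some ⟨i, hi⟩)⟩
  exact ⟨x₀, hx₀.1, fun y hy => (Set.mem_iInter.1 hmem ⟨y, hy⟩).2⟩
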